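/- For a locally integrable function \(f:\mathbb R\to\mathbb R\) let \[ \mathcal Mf(x)=\sup_{a<x<b}\frac1{b-a}\int_a^b f(y)\,dy \] be its uncentered Hardy--Littlewood maximal function, and let \[ \operatorname{var}(f)=\sup\Bigl\{-\int_{\mathbb R} f\varphi' : \varphi\in C^1_c(\mathbb R),\ |\varphi|\le 1\Bigr\}\in[0,\infty] \] be its variation. A locally integrable function \(f\) is called weakly differentiable if there is a locally integrable function \(f'\), its weak derivative, with \(\int f\varphi'=-\int f'\varphi\) for all \(\varphi\in C^1_c(\mathbb R)\). Theorem. There exists an absolute constant \(C>0\) such that for every weakly differentiable function \(f:\mathbb R\to\mathbb R\) which is even and nonincreasing on \((0,\infty)\), the maximal function \(\mathcal Mf\) is finite everywhere and weakly differentiable, and \[ \operatorname{var}\bigl((\mathcal Mf)'\bigr)\le C\operatorname{var}(f'). \] -/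

import Mathlib

open MeasureTheory
open scoped ENNReal

namespace UncenteredMaximal

/-- The set of all averages of `f` over the bounded open intervals `(a, b)` containing `x`. -/
def averages (f : ℝ → ℝ) (x : ℝ) : Set ℝ :=
  {A | ∃ a b : ℝ, a < x ∧ x < b ∧ A = (b - a)⁻¹ * ∫ y in a..b, f y}

/-- The uncentered Hardy-Littlewood maximal function on the line
(averages of `f` itself, not of its absolute value). -/
noncomputable def maximalFunction (f : ℝ → ℝ) (x : ℝ) : ℝ :=
  sSup (averages f x)

/-- `g` is a weak derivative of `f` on the line; both functions are locally integrable. -/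
structure HasWeakDeriv (f g : ℝ → ℝ) : Prop where
  locallyIntegrable : LocallyIntegrable f volume
  locallyIntegrable_deriv : LocallyIntegrable g volume
  integral_mul_deriv : ∀ φ : ℝ → ℝ, ContDiff ℝ 1 φ → HasCompactSupport φ →
    ∫ x, f x * deriv φ x = -∫ x, g x * φ x

/-- The variation on the line of a locally integrable function `g`: the supremum of
`-∫ g φ'` over all compactly supported `φ` of class `C¹` with `|φ| ≤ 1`. The supremum is
nonnegative because `φ = 0` is admissible, so nothing is lost by `ENNReal.ofReal`. -/
noncomputable def variation (g : ℝ → ℝ) : ℝ≥0∞ :=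
  ⨆ (φ : ℝ → ℝ) (_ : ContDiff ℝ 1 φ) (_ : HasCompactSupport φ) (_ : ∀ x, |φ x| ≤ 1),
    ENNReal.ofReal (-∫ x, g x * deriv φ x)

end UncenteredMaximal

/-!
Replace `f` by its continuous representative. For a continuous even `f` that decreases away from
the origin, the maximal function at `x > 0` only sees the intervals `(-s * x, x)` with `0 ≤ s ≤ 1`:
cutting an interval around the origin down to the superlevel set `{f ≥ f x}` improves its average,
and an interval avoiding the origin loses to `(0, x)`. The average over `(-s * x, x)` is a mean of
dilations, `(1 + s)⁻¹ * ∫ u in -s..1, f (x * u)`, in which `x` enters through the integrand only.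
Pointwise inequalities between the dilations of `f` therefore pass to `M f`, at the cost of
integrating their error terms over `(-1, 1)`.

Two such inequalities are used. The bound `|M f x - M f y| ≤ ∫ u in -1..1, |f (x * u) - f (y * u)|`
transfers local absolute continuity from `f` to `M f`. If `V = var f'` is finite, then `f'` is a
difference of monotone functions the second of which takes values in `[-V, V]`; integrating,
`f + K` is convex for some convex `K` with `K x ≤ V * |x|`, and so is `M f + J`, where
`J x = ∫ u in -1..1, K (x * u)` is again convex with `J x ≤ V * |x|`. A convex function bounded by
`c + V * |x|` is `V`-Lipschitz, so its derivative is monotone with values in `[-V, V]` and has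
variation at most `2 * V`. Applied to `M f + J` and to `J` this gives `var (M f)' ≤ 4 * V`.
-/

open Set Filter Topology
open scoped Convolution NNReal

namespace UncenteredMaximal

/-! ### Variation and mollification -/

theorem variation_congr_ae {g k : ℝ → ℝ} (h : g =ᵐ[volume] k) : variation g = variation k := by
  have integral_congr (φ : ℝ → ℝ) : ∫ x, g x * deriv φ x = ∫ x, k x * deriv φ x :=
    integral_congr_ae (h.mono fun x hx => by simp only [hx])
  simp only [variation, integral_congr]

theorem integrable_mul_of_hasCompactSupport {g ψ : ℝ → ℝ} (hg : LocallyIntegrable g)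
    (hψ : Continuous ψ) (hψs : HasCompactSupport ψ) : Integrable fun x => g x * ψ x := by
  simpa only [smul_eq_mul, mul_comm] using hg.integrable_smul_left_of_hasCompactSupport hψ hψs

theorem ofReal_neg_integral_mul_deriv_le_variation (g : ℝ → ℝ) {φ : ℝ → ℝ} (hφ : ContDiff ℝ 1 φ)
    (hφs : HasCompactSupport φ) (hφ1 : ∀ x, |φ x| ≤ 1) :
    ENNReal.ofReal (-∫ x, g x * deriv φ x) ≤ variation g :=
  le_iSup_of_le φ <| le_iSup_of_le hφ <| le_iSup_of_le hφs <| le_iSup_of_le hφ1 le_rfl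

theorem variation_sub_le {g k : ℝ → ℝ} (hg : LocallyIntegrable g) (hk : LocallyIntegrable k) :
    variation (fun x => g x - k x) ≤ variation g + variation k := by
  refine iSup_le fun φ => iSup_le fun hφ => iSup_le fun hφs => iSup_le fun hφ1 => ?_
  have hφ' : Continuous (deriv φ) := hφ.continuous_deriv le_rfl
  have split : -∫ x, (g x - k x) * deriv φ x =
      -(∫ x, g x * deriv φ x) + -∫ x, k x * deriv (-φ) x := by
    have hneg (x : ℝ) : deriv (-φ) x = -deriv φ x := by simp
    simp only [sub_mul, hneg, mul_neg, integral_neg]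
    rw [integral_sub (integrable_mul_of_hasCompactSupport hg hφ' hφs.deriv)
      (integrable_mul_of_hasCompactSupport hk hφ' hφs.deriv)]
    ring
  calc ENNReal.ofReal (-∫ x, (g x - k x) * deriv φ x)
      ≤ ENNReal.ofReal (-∫ x, g x * deriv φ x) + ENNReal.ofReal (-∫ x, k x * deriv (-φ) x) :=
        split ▸ ENNReal.ofReal_add_le
    _ ≤ variation g + variation k := add_le_add
        (ofReal_neg_integral_mul_deriv_le_variation g hφ hφs hφ1)
        (ofReal_neg_integral_mul_deriv_le_variation k hφ.neg hφs.neg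
          fun x => (abs_neg (φ x)).trans_le (hφ1 x))

section Mollification

variable {ρ q : ℝ → ℝ}

theorem hasCompactSupport_integral_sub (hρ : HasCompactSupport ρ) {u v : ℝ} (huv : u ≤ v) :
    HasCompactSupport fun y => ∫ t in u - y..v - y, ρ t := by
  obtain ⟨r, hr⟩ := hρ.isCompact.isBounded.subset_closedBall 0
  refine .intro (isCompact_Icc (a := u - r) (b := v + r)) fun y hy =>
    intervalIntegral.integral_zero_ae (.of_forall fun t ht => ?_)
  rw [uIoc_of_le (sub_le_sub_right huv y)] at ht
  refine image_eq_zero_of_notMem_tsupport fun hts => hy ?_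
  have htr := abs_le.1 (mem_closedBall_zero_iff.1 (hr hts))
  constructor <;> linarith [ht.1, ht.2, htr.1, htr.2]

theorem hasDerivAt_integral_sub (hρ : Continuous ρ) (u v y : ℝ) :
    HasDerivAt (fun y => ∫ t in u - y..v - y, ρ t) (ρ (u - y) - ρ (v - y)) y := by
  have primitive (w : ℝ) : HasDerivAt (fun y => ∫ t in 0..w - y, ρ t) (-ρ (w - y)) y := by
    simpa using (hρ.integral_hasStrictDerivAt 0 (w - y)).hasDerivAt.comp_const_sub w y
  have eq : (fun y => ∫ t in u - y..v - y, ρ t) =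
      fun y => (∫ t in 0..v - y, ρ t) - ∫ t in 0..u - y, ρ t := funext fun y =>
    (intervalIntegral.integral_interval_sub_left (hρ.intervalIntegrable _ _)
      (hρ.intervalIntegrable _ _)).symm
  rw [eq]
  exact ((primitive v).sub (primitive u)).congr_deriv (by ring)

theorem exists_test_function_deriv_eq_sum (hρ : Continuous ρ) (hρs : HasCompactSupport ρ)
    (hρ0 : 0 ≤ ρ) (hρ1 : ∫ x, ρ x = 1) {u s : ℕ → ℝ} (hu : Monotone u) (hs : ∀ i, |s i| ≤ 1)
    (n : ℕ) :
    ∃ φ : ℝ → ℝ, ContDiff ℝ 1 φ ∧ HasCompactSupport φ ∧ (∀ y, |φ y| ≤ 1) ∧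
      ∀ y, deriv φ y = ∑ i ∈ Finset.range n, s i * (ρ (u i - y) - ρ (u (i + 1) - y)) := by
  -- `0 ≤ J i` and the windows `[u i - y, u (i + 1) - y]` are adjacent, so `|φ| ≤ ∑ J i ≤ ∫ ρ = 1`.
  set J : ℕ → ℝ → ℝ := fun i y => ∫ t in u i - y..u (i + 1) - y, ρ t
  have hJ0 (i : ℕ) (y : ℝ) : 0 ≤ J i y :=
    intervalIntegral.integral_nonneg (sub_le_sub_right (hu i.le_succ) y) fun t _ => hρ0 t
  have hasDeriv (y : ℝ) : HasDerivAt (fun y => ∑ i ∈ Finset.range n, s i * J i y)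
      (∑ i ∈ Finset.range n, s i * (ρ (u i - y) - ρ (u (i + 1) - y))) y :=
    .fun_sum fun i _ => (hasDerivAt_integral_sub hρ (u i) (u (i + 1)) y).const_mul (s i)
  refine ⟨fun y => ∑ i ∈ Finset.range n, s i * J i y,
    contDiff_one_iff_deriv.2 ⟨fun y => (hasDeriv y).differentiableAt, ?_⟩, ?_, fun y => ?_,
    fun y => (hasDeriv y).deriv⟩
  · rw [funext fun y => (hasDeriv y).deriv]
    fun_prop
  · rw [← Finset.sum_fn]
    exact Finset.sum_induction _ HasCompactSupport (fun _ _ => .add) .zero fun i _ =>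
      (hasCompactSupport_integral_sub hρs (hu i.le_succ)).mul_left
  · calc |∑ i ∈ Finset.range n, s i * J i y|
        ≤ ∑ i ∈ Finset.range n, |s i * J i y| := Finset.abs_sum_le_sum_abs _ _
      _ ≤ ∑ i ∈ Finset.range n, J i y := Finset.sum_le_sum fun i _ => by
        rw [abs_mul, abs_of_nonneg (hJ0 i y)]
        exact mul_le_of_le_one_left (hJ0 i y) (hs i)
      _ = ∫ t in u 0 - y..u n - y, ρ t :=
        intervalIntegral.sum_integral_adjacent_intervals (a := fun i => u i - y)
          fun _ _ => hρ.intervalIntegrable _ _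
      _ ≤ ∫ t, ρ t := by
        rw [intervalIntegral.integral_of_le (sub_le_sub_right (hu n.zero_le) y)]
        exact setIntegral_le_integral (hρ.integrable_of_hasCompactSupport hρs) (.of_forall hρ0)
      _ = 1 := hρ1

theorem eVariationOn_convolution_le (hρ : Continuous ρ) (hρs : HasCompactSupport ρ)
    (hρ0 : 0 ≤ ρ) (hρ1 : ∫ x, ρ x = 1) (hq : LocallyIntegrable q) :
    eVariationOn (ρ ⋆[ContinuousLinearMap.lsmul ℝ ℝ] q) univ ≤ variation q := by
  refine iSup_le fun ⟨n, u, hu, _⟩ => ?_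
  set Q := ρ ⋆[ContinuousLinearMap.lsmul ℝ ℝ] q
  set s : ℕ → ℝ := fun i => (SignType.sign (Q (u (i + 1)) - Q (u i)) : ℝ)
  have hs (i : ℕ) : |s i| ≤ 1 := by
    rcases h : SignType.sign (Q (u (i + 1)) - Q (u i)) with _ | _ | _ <;> simp [s, h]
  -- Pairing `q` with this `φ'` produces the increments of `ρ ⋆ q`, and `s` makes them positive.
  obtain ⟨φ, hφ, hφs, hφ1, hφ'⟩ := exists_test_function_deriv_eq_sum hρ hρs hρ0 hρ1 hu hs n
  have hint (w : ℝ) : Integrable fun y => q y * ρ (w - y) :=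
    integrable_mul_of_hasCompactSupport hq (hρ.comp (continuous_sub_left w))
      (hρs.comp_homeomorph (Homeomorph.subLeft w))
  have hQ (w : ℝ) : Q w = ∫ y, q y * ρ (w - y) := by
    simp only [Q, convolution_lsmul_swap, smul_eq_mul, mul_comm]
  have pairing : -∫ y, q y * deriv φ y = ∑ i ∈ Finset.range n, |Q (u (i + 1)) - Q (u i)| := by
    have increment (i : ℕ) : ∫ y, s i * (q y * ρ (u i - y) - q y * ρ (u (i + 1) - y)) =
        -|Q (u (i + 1)) - Q (u i)| := by
      rw [integral_const_mul, integral_sub (hint _) (hint _), ← hQ, ← hQ, ← sign_mul_self]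
      ring
    simp_rw [hφ', Finset.mul_sum, mul_left_comm (q _), mul_sub (q _)]
    rw [integral_finsetSum _ fun i _ => by exact ((hint _).sub (hint _)).const_mul (s i)]
    simp only [increment, Finset.sum_neg_distrib, neg_neg]
  calc ∑ i ∈ Finset.range n, edist (Q (u (i + 1))) (Q (u i))
      = ENNReal.ofReal (∑ i ∈ Finset.range n, |Q (u (i + 1)) - Q (u i)|) := by
        rw [ENNReal.ofReal_sum_of_nonneg fun _ _ => abs_nonneg _]
        simp only [edist_dist, Real.dist_eq]
    _ ≤ variation q := pairing ▸ ofReal_neg_integral_mul_deriv_le_variation q hφ hφs hφ1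

end Mollification

-- Mollifications of `q` converge at its Lebesgue points, and `eVariationOn` is lower
-- semicontinuous under pointwise convergence.
theorem exists_conull_eVariationOn_le {q : ℝ → ℝ} (hq : LocallyIntegrable q) :
    ∃ D : Set ℝ, (∀ᵐ x, x ∈ D) ∧ eVariationOn q D ≤ variation q := by
  let B (n : ℕ) : ContDiffBump (0 : ℝ) :=
    ⟨1 / (n + 1), 2 * (1 / (n + 1)), by positivity, lt_mul_left (by positivity) one_lt_two⟩
  have hB : Tendsto (fun n => (B n).rOut) atTop (𝓝 0) := by
    simpa [B] using tendsto_one_div_add_atTop_nhds_zero_nat (𝕜 := ℝ).const_mul 2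
  refine ⟨_, ContDiffBump.ae_convolution_tendsto_right_of_locallyIntegrable hB
    (.of_forall fun n => le_rfl) hq, le_of_not_gt fun hlt => ?_⟩
  obtain ⟨n, hn⟩ := (eVariationOn.lowerSemicontinuous_aux (fun x hx => hx) hlt).exists
  exact hn.not_ge <| (eVariationOn.mono _ (subset_univ _)).trans <|
    eVariationOn_convolution_le (B n).continuous_normed (B n).hasCompactSupport_normed
      (fun x => (B n).nonneg_normed x) (B n).integral_normed hq

theorem exists_ae_eq_const_of_integral_mul_deriv_eq_zero {w : ℝ → ℝ} (hw : LocallyIntegrable w)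
    (h : ∀ φ : ℝ → ℝ, ContDiff ℝ 1 φ → HasCompactSupport φ → ∫ x, w x * deriv φ x = 0) :
    ∃ c : ℝ, ∀ᵐ x, w x = c := by
  have variation_eq : variation w = 0 :=
    nonpos_iff_eq_zero.1 <| iSup_le fun φ => iSup_le fun hφ => iSup_le fun hφs =>
      iSup_le fun _ => by simp [h φ hφ hφs]
  obtain ⟨D, hD, hwD⟩ := exists_conull_eVariationOn_le hw
  rw [variation_eq, nonpos_iff_eq_zero, eVariationOn.eq_zero_iff] at hwD
  obtain ⟨a, ha⟩ := hD.exists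
  exact ⟨w a, hD.mono fun x hx => edist_eq_zero.1 (hwD x hx a ha)⟩

/-! ### Monotone and convex functions -/

theorem exists_monotone_extension_of_abs_le {g : ℝ → ℝ} {D : Set ℝ} {B : ℝ} (hB : 0 ≤ B)
    (hg : MonotoneOn g D) (hgB : ∀ x ∈ D, |g x| ≤ B) :
    ∃ m : ℝ → ℝ, Monotone m ∧ EqOn m g D ∧ ∀ x, |m x| ≤ B := by
  obtain ⟨m, hm, hmg⟩ := hg.exists_monotone_extension
    ⟨-B, forall_mem_image.2 fun x hx => (abs_le.1 (hgB x hx)).1⟩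
    ⟨B, forall_mem_image.2 fun x hx => (abs_le.1 (hgB x hx)).2⟩
  refine ⟨fun x => max (-B) (min B (m x)),
    fun x y hxy => max_le_max_left _ (min_le_min_left _ (hm hxy)), fun x hx => ?_,
    fun x => abs_le.2 ⟨le_max_left _ _, max_le (neg_le_self hB) (min_le_left _ _)⟩⟩
  obtain ⟨hl, hu⟩ := abs_le.1 (hgB x hx)
  beta_reduce
  rw [← hmg hx, min_eq_right hu, max_eq_right hl]

theorem exists_monotone_add_ae_eq_monotone {q : ℝ → ℝ} (hq : LocallyIntegrable q)
    (hV : variation q ≠ ∞) :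
    ∃ n m : ℝ → ℝ, Monotone n ∧ (∀ x, |n x| ≤ (variation q).toReal) ∧ Monotone m ∧
      ∀ᵐ x, q x + n x = m x := by
  obtain ⟨D, hD, hle⟩ := exists_conull_eVariationOn_le hq
  obtain ⟨a, ha⟩ := hD.exists
  have hbv : BoundedVariationOn q D := ne_top_of_le_ne_top hV hle
  have hloc := hbv.locallyBoundedVariationOn
  have hleR : (eVariationOn q D).toReal ≤ (variation q).toReal := ENNReal.toReal_mono hV hle
  set v := variationOnFromTo q D a
  have hv (x : ℝ) : |v x| ≤ (variation q).toReal :=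
    (variationOnFromTo.abs_le_eVariationOn hbv).trans hleR
  have hvq (x : ℝ) (hx : x ∈ D) :
      |(v + q) x| ≤ (variation q).toReal + ((variation q).toReal + |q a|) := by
    have hqa : |q x - q a| ≤ (variation q).toReal := (hbv.dist_le hx ha).trans hleR
    refine (abs_add_le _ _).trans (add_le_add (hv x) ?_)
    linarith [abs_sub_abs_le_abs_sub (q x) (q a)]
  obtain ⟨n, hn, hnD, hnV⟩ := exists_monotone_extension_of_abs_le ENNReal.toReal_nonneg
    (variationOnFromTo.monotoneOn hloc ha) fun x _ => hv x
  obtain ⟨m, hm, hmD, -⟩ := exists_monotone_extension_of_abs_le (by positivity)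
    (variationOnFromTo.add_self_monotoneOn hloc ha) hvq
  refine ⟨n, m, hn, hnV, hm, hD.mono fun x hx => ?_⟩
  rw [hnD hx, hmD hx, Pi.add_apply, add_comm]

theorem intervalIntegrable_of_locallyIntegrable {q : ℝ → ℝ} (hq : LocallyIntegrable q) (a b : ℝ) :
    IntervalIntegrable q volume a b :=
  (hq.integrableOn_isCompact isCompact_uIcc).intervalIntegrable

theorem convexOn_integral_of_monotone {m : ℝ → ℝ} (hm : Monotone m) (a : ℝ) :
    ConvexOn ℝ univ fun x => ∫ t in a..x, m t := by
  have hint (x y : ℝ) : IntervalIntegrable m volume x y := hm.intervalIntegrable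
  refine convexOn_of_slope_mono_adjacent convex_univ fun {x y z} _ _ hxy hyz => ?_
  simp only [intervalIntegral.integral_interval_sub_left (hint _ _) (hint _ _)]
  calc (∫ t in x..y, m t) / (y - x) ≤ m y := by
        rw [div_le_iff₀ (sub_pos.2 hxy), mul_comm, ← smul_eq_mul,
          ← intervalIntegral.integral_const]
        exact intervalIntegral.integral_mono_on hxy.le (hint _ _) (by simp) fun t ht => hm ht.2
    _ ≤ (∫ t in y..z, m t) / (z - y) := by
        rw [le_div_iff₀ (sub_pos.2 hyz), mul_comm, ← smul_eq_mul,
          ← intervalIntegral.integral_const]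
        exact intervalIntegral.integral_mono_on hyz.le (by simp) (hint _ _) fun t ht => hm ht.1

theorem tendsto_const_add_mul_div_sub_atTop (c L y : ℝ) :
    Tendsto (fun z => (c + L * z) / (z - y)) atTop (𝓝 L) := by
  have hlim : Tendsto (fun z => L + (c + L * y) / (z - y)) atTop (𝓝 (L + 0)) :=
    tendsto_const_nhds.add
      (tendsto_const_nhds.div_atTop (tendsto_atTop_add_const_right _ (-y) tendsto_id))
  rw [add_zero] at hlim
  refine hlim.congr' ((eventually_gt_atTop y).mono fun z hz => ?_)
  have : z - y ≠ 0 := (sub_pos.2 hz).ne'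
  field_simp
  ring

theorem sub_le_mul_sub_of_convexOn_of_le {H : ℝ → ℝ} (hH : ConvexOn ℝ univ H) {c L : ℝ}
    (hL : ∀ x, H x ≤ c + L * |x|) {x y : ℝ} (hxy : x ≤ y) : H y - H x ≤ L * (y - x) := by
  rcases hxy.eq_or_lt with rfl | hxy
  · simp
  rw [← div_le_iff₀ (sub_pos.2 hxy)]
  refine ge_of_tendsto (tendsto_const_add_mul_div_sub_atTop (c - H x) L x) ?_
  filter_upwards [eventually_gt_atTop y, eventually_ge_atTop 0] with z hyz hz
  calc (H y - H x) / (y - x) ≤ (H z - H x) / (z - x) :=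
        hH.secant_mono trivial trivial trivial hxy.ne' (hxy.trans hyz).ne' hyz.le
    _ ≤ (c - H x + L * z) / (z - x) := by
        have := hL z
        rw [abs_of_nonneg hz] at this
        exact div_le_div_of_nonneg_right (by linarith) (sub_pos.2 (hxy.trans hyz)).le

theorem lipschitzWith_of_convexOn_of_le {H : ℝ → ℝ} (hH : ConvexOn ℝ univ H) {c : ℝ} {L : ℝ≥0}
    (hL : ∀ x, H x ≤ c + L * |x|) : LipschitzWith L H := by
  have hH' : ConvexOn ℝ univ fun x => H (-x) := by
    exact hH.comp_linearMap (-LinearMap.id)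
  refine LipschitzWith.of_le_add_mul L fun x y => ?_
  rcases le_total x y with hxy | hxy
  · have := sub_le_mul_sub_of_convexOn_of_le hH' (fun x => by simpa using hL (-x))
      (neg_le_neg hxy)
    simp only [neg_neg] at this
    rw [Real.dist_eq, abs_of_nonpos (sub_nonpos.2 hxy)]
    linarith
  · have := sub_le_mul_sub_of_convexOn_of_le hH hL hxy
    rw [Real.dist_eq, abs_of_nonneg (sub_nonneg.2 hxy)]
    linarith

theorem exists_monotone_ae_eq_deriv {H : ℝ → ℝ} (hH : ConvexOn ℝ univ H) {L : ℝ≥0}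
    (hL : LipschitzWith L H) :
    ∃ m : ℝ → ℝ, Monotone m ∧ (∀ x, |m x| ≤ L) ∧ deriv H =ᵐ[volume] m := by
  have hmono : MonotoneOn (deriv H) {x | DifferentiableAt ℝ H x} := by
    intro x hx y hy hxy
    rcases hxy.eq_or_lt with rfl | hxy
    · rfl
    exact (hH.deriv_le_slope trivial trivial hxy hx).trans
      (hH.slope_le_deriv trivial trivial hxy hy)
  obtain ⟨m, hm, hmH, hmL⟩ := exists_monotone_extension_of_abs_le L.2 hmono
    fun x _ => norm_deriv_le_of_lipschitz hL
  exact ⟨m, hm, hmL, hL.ae_differentiableAt_real.mono fun x hx => (hmH hx).symm⟩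

theorem hasDerivAt_integral_mul_comp_sub {g φ : ℝ → ℝ} (hg : LocallyIntegrable g)
    (hφ : ContDiff ℝ 1 φ) (hφs : HasCompactSupport φ) :
    HasDerivAt (fun h => ∫ x, g x * φ (x - h)) (-∫ x, g x * deriv φ x) 0 := by
  have := (hφs.comp_homeomorph (Homeomorph.neg ℝ)).hasDerivAt_convolution_right
    (ContinuousLinearMap.lsmul ℝ ℝ) hg (hφ.comp contDiff_neg) 0
  convert! this using 1
  · funext h
    simp [MeasureTheory.convolution]
  · simp [MeasureTheory.convolution, deriv_comp_neg, Function.comp_def, integral_neg]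

theorem integral_sub_mul_le_of_monotone {m φ : ℝ → ℝ} (hm : Monotone m) {A B : ℝ}
    (hmem : ∀ x, m x ∈ Icc A B) (hφ : Continuous φ) (hφs : HasCompactSupport φ)
    (hφ1 : ∀ x, |φ x| ≤ 1) {h : ℝ} (hh : 0 ≤ h) :
    ∫ x, (m (x + h) - m x) * φ x ≤ (B - A) * h := by
  obtain ⟨R, hR, hφR⟩ := hφs.exists_pos_le_norm
  have hmh : Monotone fun x => m (x + h) := fun x y hxy => hm (by gcongr)
  have hint (a b : ℝ) : IntervalIntegrable m volume a b := hm.intervalIntegrable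
  have hinth (a b : ℝ) : IntervalIntegrable (fun x => m (x + h)) volume a b :=
    hmh.intervalIntegrable
  calc ∫ x, (m (x + h) - m x) * φ x = ∫ x in -R..R, (m (x + h) - m x) * φ x := by
        refine (intervalIntegral.integral_eq_integral_of_support_subset fun x hx => ?_).symm
        have := abs_lt.1 (lt_of_not_ge fun hRx => right_ne_zero_of_mul hx (hφR x hRx))
        exact ⟨this.1, this.2.le⟩
    _ ≤ ∫ x in -R..R, (m (x + h) - m x) := by
        refine intervalIntegral.integral_mono_on (by linarith)
          (((hinth _ _).sub (hint _ _)).mul_continuousOn hφ.continuousOn)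
          ((hinth _ _).sub (hint _ _)) fun x _ => ?_
        exact mul_le_of_le_one_right (sub_nonneg.2 (hm (by linarith)))
          ((le_abs_self _).trans (hφ1 x))
    _ = (∫ x in R..R + h, m x) - ∫ x in -R..-R + h, m x := by
        rw [intervalIntegral.integral_sub (hinth _ _) (hint _ _),
          intervalIntegral.integral_comp_add_right]
        have := intervalIntegral.integral_interval_sub_interval_comm' (hint (-R + h) (R + h))
          (hint (-R) R) (hint (-R + h) (-R))
        linarith
    _ ≤ (∫ _ in R..R + h, B) - ∫ _ in -R..-R + h, A := sub_le_sub
        (intervalIntegral.integral_mono_on (by linarith) (hint _ _) (by simp) fun x _ =>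
          (hmem x).2)
        (intervalIntegral.integral_mono_on (by linarith) (by simp) (hint _ _) fun x _ =>
          (hmem x).1)
    _ = (B - A) * h := by
        simp only [intervalIntegral.integral_const, smul_eq_mul]
        ring

theorem variation_le_of_monotone {m : ℝ → ℝ} (hm : Monotone m) {A B : ℝ}
    (hmem : ∀ x, m x ∈ Icc A B) : variation m ≤ ENNReal.ofReal (B - A) := by
  refine iSup_le fun φ => iSup_le fun hφ => iSup_le fun hφs => iSup_le fun hφ1 =>
    ENNReal.ofReal_le_ofReal ?_
  have hmloc : LocallyIntegrable m := hm.locallyIntegrable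
  -- Difference quotients move from `φ` to `m`, where monotonicity bounds them.
  have hslope := (hasDerivAt_integral_mul_comp_sub hmloc hφ hφs).tendsto_slope_zero_right
  refine le_of_tendsto hslope (eventually_mem_nhdsWithin.mono fun h hh => ?_)
  rw [mem_Ioi] at hh
  have hint (t : ℝ) : Integrable fun x => m x * φ (x - t) :=
    integrable_mul_of_hasCompactSupport hmloc (hφ.continuous.comp (continuous_sub_right t))
      (hφs.comp_homeomorph (Homeomorph.subRight t))
  have hint' : Integrable fun x => m (x + h) * φ x := by
    simpa using (hint h).comp_add_right h
  have shift : (∫ x, m x * φ (x - (0 + h))) - ∫ x, m x * φ (x - 0) =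
      ∫ x, (m (x + h) - m x) * φ x := by
    simp_rw [sub_mul]
    rw [integral_sub hint' (by simpa using hint 0),
      ← integral_add_right_eq_self (fun x => m x * φ (x - (0 + h))) h]
    simp
  rw [shift, smul_eq_mul, inv_mul_le_iff₀ hh, mul_comm]
  exact integral_sub_mul_le_of_monotone hm hmem hφ.continuous hφs hφ1 hh.le

theorem locallyIntegrable_deriv_of_lipschitzWith {H : ℝ → ℝ} {L : ℝ≥0} (hH : LipschitzWith L H) :
    LocallyIntegrable (deriv H) :=
  (locallyIntegrable_const (L : ℝ)).mono (aestronglyMeasurable_deriv H volume) <|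
    .of_forall fun _ => (norm_deriv_le_of_lipschitz hH).trans (le_abs_self _)

theorem variation_deriv_le_of_convexOn {H : ℝ → ℝ} (hH : ConvexOn ℝ univ H) {L : ℝ≥0}
    (hL : LipschitzWith L H) : variation (deriv H) ≤ 2 * L := by
  obtain ⟨m, hm, hmL, hHm⟩ := exists_monotone_ae_eq_deriv hH hL
  calc variation (deriv H) = variation m := variation_congr_ae hHm
    _ ≤ ENNReal.ofReal (L - -L) := variation_le_of_monotone hm fun x => abs_le.1 (hmL x)
    _ = 2 * L := by
      rw [sub_neg_eq_add, ← two_mul, ENNReal.ofReal_mul zero_le_two, ENNReal.ofReal_coe_nnreal,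
        ENNReal.ofReal_ofNat]

theorem variation_deriv_le_of_convexOn_add {M K : ℝ → ℝ} (hK : ConvexOn ℝ univ K)
    (hMK : ConvexOn ℝ univ fun x => M x + K x) {c : ℝ} {L : ℝ≥0} (hM : ∀ x, M x ≤ c)
    (hKL : ∀ x, K x ≤ L * |x|) : variation (deriv M) ≤ 4 * L := by
  have hKlip : LipschitzWith L K :=
    lipschitzWith_of_convexOn_of_le hK (c := 0) fun x => by simpa using hKL x
  have hMKlip : LipschitzWith L fun x => M x + K x :=
    lipschitzWith_of_convexOn_of_le hMK fun x => add_le_add (hM x) (hKL x)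
  have deriv_eq : deriv M =ᵐ[volume] fun x => deriv (fun x => M x + K x) x - deriv K x := by
    filter_upwards [hKlip.ae_differentiableAt_real, hMKlip.ae_differentiableAt_real]
      with x hKx hMKx
    rw [← deriv_fun_sub hMKx hKx]
    simp only [add_sub_cancel_right]
  calc variation (deriv M)
      = variation fun x => deriv (fun x => M x + K x) x - deriv K x := variation_congr_ae deriv_eq
    _ ≤ variation (deriv fun x => M x + K x) + variation (deriv K) :=
      variation_sub_le (locallyIntegrable_deriv_of_lipschitzWith hMKlip)
        (locallyIntegrable_deriv_of_lipschitzWith hKlip)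
    _ ≤ 2 * L + 2 * L := add_le_add (variation_deriv_le_of_convexOn hMK hMKlip)
        (variation_deriv_le_of_convexOn hK hKlip)
    _ = 4 * L := by ring

/-! ### Averages of bell-shaped functions -/

theorem average_le_average_of_threshold {f : ℝ → ℝ} (hf : LocallyIntegrable f) {a b c d l : ℝ}
    (hac : a ≤ c) (hcd : c < d) (hdb : d ≤ b) (hin : ∀ y ∈ Ioo c d, l ≤ f y)
    (hleft : ∀ y ∈ Ioo a c, f y ≤ l) (hright : ∀ y ∈ Ioo d b, f y ≤ l) :
    (b - a)⁻¹ * ∫ y in a..b, f y ≤ (d - c)⁻¹ * ∫ y in c..d, f y := by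
  have hint (s t : ℝ) : IntervalIntegrable f volume s t :=
    intervalIntegrable_of_locallyIntegrable hf s t
  have hconst (s t : ℝ) : ∫ _ in s..t, l = (t - s) * l := by simp
  have left : ∫ y in a..c, f y ≤ (c - a) * l := hconst a c ▸
    intervalIntegral.integral_mono_on_of_le_Ioo hac (hint _ _) (by simp) hleft
  have right : ∫ y in d..b, f y ≤ (b - d) * l := hconst d b ▸
    intervalIntegral.integral_mono_on_of_le_Ioo hdb (hint _ _) (by simp) hright
  have inside : (d - c) * l ≤ ∫ y in c..d, f y := hconst c d ▸
    intervalIntegral.integral_mono_on_of_le_Ioo hcd.le (by simp) (hint _ _) hin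
  rw [← intervalIntegral.integral_add_adjacent_intervals (hint a c) (hint c b),
    ← intervalIntegral.integral_add_adjacent_intervals (hint c d) (hint d b),
    inv_mul_le_iff₀ (by linarith), ← mul_assoc, ← div_eq_mul_inv, div_mul_eq_mul_div,
    le_div_iff₀ (by linarith)]
  have outside := mul_le_mul_of_nonneg_right (add_le_add left right) (sub_nonneg.2 hcd.le)
  have inside' := mul_le_mul_of_nonneg_left inside
    (add_nonneg (sub_nonneg.2 hac) (sub_nonneg.2 hdb))
  linarith

/-- The class of functions to which the problem reduces after choosing the continuous
representative of `f`: continuous, even and nonincreasing away from the origin. -/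
structure Bell (f : ℝ → ℝ) : Prop where
  continuous : Continuous f
  even : Function.Even f
  antitoneOn : AntitoneOn f (Ici 0)

/-- For `x > 0` the average of `f` over `(-s * x, x)`, parametrized by the dilations `x * u` of
`u ∈ (-s, 1)`, so that `x` enters through the integrand only. -/
noncomputable def dilationMean (f : ℝ → ℝ) (s x : ℝ) : ℝ :=
  (1 + s)⁻¹ * ∫ u in -s..1, f (x * u)

theorem dilationMean_eq_average (f : ℝ → ℝ) (s : ℝ) {x : ℝ} (hx : x ≠ 0) :
    dilationMean f s x = (x - -s * x)⁻¹ * ∫ y in -s * x..x, f y := by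
  have length : x - -s * x = (1 + s) * x := by ring
  rw [dilationMean, intervalIntegral.integral_comp_mul_left _ hx, smul_eq_mul, ← mul_assoc,
    ← mul_inv, length, mul_one, mul_comm x (-s)]

theorem averages_congr_ae {f g : ℝ → ℝ} (h : f =ᵐ[volume] g) (x : ℝ) :
    averages f x = averages g x := by
  have (a b : ℝ) : ∫ y in a..b, f y = ∫ y in a..b, g y :=
    intervalIntegral.integral_congr_ae (h.mono fun y hy _ => hy)
  simp only [averages, this]

theorem averages_nonempty (f : ℝ → ℝ) (x : ℝ) : (averages f x).Nonempty :=
  ⟨_, x - 1, x + 1, by linarith, by linarith, rfl⟩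

theorem averages_neg_of_even {f : ℝ → ℝ} (hf : Function.Even f) (x : ℝ) :
    averages f (-x) = averages f x := by
  have subset (x : ℝ) : averages f x ⊆ averages f (-x) := by
    rintro _ ⟨a, b, hax, hxb, rfl⟩
    refine ⟨-b, -a, neg_lt_neg hxb, neg_lt_neg hax, ?_⟩
    have := intervalIntegral.integral_comp_neg (a := a) (b := b) f
    simp only [hf _] at this
    rw [this, neg_sub_neg]
  exact Subset.antisymm (by simpa using subset (-x)) (subset x)

namespace Bell

variable {f : ℝ → ℝ}

theorem apply_abs (hf : Bell f) (x : ℝ) : f |x| = f x := by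
  rcases abs_choice x with h | h <;> rw [h]
  exact hf.even x

theorem le_of_abs_le (hf : Bell f) {x y : ℝ} (h : |x| ≤ |y|) : f y ≤ f x := by
  rw [← hf.apply_abs x, ← hf.apply_abs y]
  exact hf.antitoneOn (abs_nonneg x) (abs_nonneg y) h

theorem averages_abs (hf : Bell f) (x : ℝ) : averages f |x| = averages f x := by
  rcases abs_choice x with h | h <;> rw [h]
  exact averages_neg_of_even hf.even x

theorem dilationMean_abs (hf : Bell f) (s x : ℝ) : dilationMean f s |x| = dilationMean f s x := by
  have (u : ℝ) : f (|x| * u) = f (x * u) := by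
    rw [← hf.apply_abs, ← hf.apply_abs (x * u), abs_mul, abs_abs, abs_mul]
  simp only [dilationMean, this]

theorem averages_le (hf : Bell f) {x A : ℝ} (hA : A ∈ averages f x) : A ≤ f 0 := by
  obtain ⟨a, b, hax, hxb, rfl⟩ := hA
  have hab : a < b := hax.trans hxb
  rw [inv_mul_le_iff₀ (sub_pos.2 hab), ← smul_eq_mul, ← intervalIntegral.integral_const]
  exact intervalIntegral.integral_mono_on hab.le (hf.continuous.intervalIntegrable a b) (by simp)
    fun y _ => hf.le_of_abs_le (by simp)

theorem bddAbove_averages (hf : Bell f) (x : ℝ) : BddAbove (averages f x) :=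
  ⟨f 0, fun _ hA => hf.averages_le hA⟩

theorem maximalFunction_le (hf : Bell f) (x : ℝ) : maximalFunction f x ≤ f 0 :=
  csSup_le (averages_nonempty f x) fun _ hA => hf.averages_le hA

theorem average_le_dilationMean_zero (hf : Bell f) {a b x : ℝ} (ha : 0 ≤ a) (hax : a < x)
    (hxb : x < b) : (b - a)⁻¹ * ∫ y in a..b, f y ≤ dilationMean f 0 x := by
  have hab : a < b := hax.trans hxb
  have affine : (b - a)⁻¹ * ∫ y in a..b, f y = ∫ u in 0..1, f (a + (b - a) * u) := by
    rw [intervalIntegral.integral_comp_add_mul f (sub_pos.2 hab).ne']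
    simp
  simp only [dilationMean, affine, neg_zero, add_zero, inv_one, one_mul]
  have hc := hf.continuous
  refine intervalIntegral.integral_mono_on zero_le_one
    (Continuous.intervalIntegrable (by fun_prop) _ _)
    (Continuous.intervalIntegrable (by fun_prop) _ _) fun u hu => ?_
  have h0 : 0 ≤ x * u := mul_nonneg (ha.trans hax.le) hu.1
  have h1 : x * u ≤ a + (b - a) * u := by nlinarith [hu.1, hu.2]
  exact hf.antitoneOn h0 (h0.trans h1) h1

theorem exists_le_dilationMean (hf : Bell f) {x A : ℝ} (hA : A ∈ averages f x) :
    ∃ s ∈ Icc (0 : ℝ) 1, A ≤ dilationMean f s x := by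
  wlog hx : 0 ≤ x generalizing x
  · simpa only [hf.dilationMean_abs] using this ((hf.averages_abs x).symm ▸ hA) (abs_nonneg x)
  rcases hx.eq_or_lt with rfl | hx
  · exact ⟨0, by simp, by simpa [dilationMean] using hf.averages_le hA⟩
  obtain ⟨a, b, hax, hxb, rfl⟩ := hA
  rcases le_total 0 a with ha | ha
  · exact ⟨0, by simp, hf.average_le_dilationMean_zero ha hax hxb⟩
  set c := max a (-x)
  have hcx : c < x := max_lt hax (by linarith)
  have hxc : -x ≤ c := le_max_right _ _
  have hc0 : c ≤ 0 := max_le ha (by linarith)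
  refine ⟨-c / x, ⟨div_nonneg (neg_nonneg.2 hc0) hx.le, (div_le_one hx).2 (by linarith)⟩, ?_⟩
  rw [dilationMean_eq_average f _ hx.ne', neg_div, neg_neg, div_mul_cancel₀ c hx.ne']
  refine average_le_average_of_threshold hf.continuous.locallyIntegrable (l := f x)
    (le_max_left _ _) hcx hxb.le (fun y hy => hf.le_of_abs_le ?_)
    (fun y hy => hf.le_of_abs_le ?_) fun y hy => hf.le_of_abs_le ?_
  · rw [abs_of_pos hx]
    exact abs_le.2 ⟨hxc.trans hy.1.le, hy.2.le⟩
  · have hyx : y < -x := (lt_max_iff.1 hy.2).resolve_left hy.1.not_gt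
    rw [abs_of_pos hx]
    exact (le_neg_of_le_neg hyx.le).trans (neg_le_abs y)
  · rw [abs_of_pos hx]
    exact hy.1.le.trans (le_abs_self y)

theorem dilationMean_le_maximalFunction (hf : Bell f) {s : ℝ} (hs : 0 ≤ s) (x : ℝ) :
    dilationMean f s x ≤ maximalFunction f x := by
  wlog hx : 0 ≤ x generalizing x
  · simpa only [hf.dilationMean_abs, maximalFunction, hf.averages_abs] using
      this |x| (abs_nonneg x)
  -- `(-s * x, x)` does not contain its endpoint `x`, so `averages` only admits enlargements of it.
  have hcont : ContinuousAt (fun δ => dilationMean f (s + δ) (x + δ)) 0 := by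
    have hc := hf.continuous
    have hprim : Continuous fun δ : ℝ => ∫ u in 1..-(s + δ), f ((x + δ) * u) :=
      intervalIntegral.continuous_parametric_intervalIntegral_of_continuous
        (by fun_prop) (by fun_prop)
    simp only [dilationMean, intervalIntegral.integral_symm 1]
    exact ContinuousAt.mul (ContinuousAt.inv₀ (by fun_prop) (by positivity))
      hprim.neg.continuousAt
  have hlim := hcont.tendsto.mono_left (nhdsWithin_le_nhds (s := Ioi 0))
  simp only [add_zero] at hlim
  refine le_of_tendsto hlim (eventually_mem_nhdsWithin.mono fun δ hδ => ?_)
  rw [mem_Ioi] at hδ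
  refine le_csSup (hf.bddAbove_averages x) ⟨-(s + δ) * (x + δ), x + δ, ?_, by linarith,
    dilationMean_eq_average f _ (by positivity)⟩
  nlinarith [mul_pos (add_pos_of_nonneg_of_pos hs hδ) (add_pos_of_nonneg_of_pos hx hδ)]

theorem maximalFunction_le_of_dilations_le (hf : Bell f) {k : ℝ → ℝ} {x y z α β : ℝ} (hα : 0 ≤ α)
    (hβ : 0 ≤ β) (hk : Continuous k) (hk0 : 0 ≤ k)
    (h : ∀ u, f (z * u) ≤ α * f (x * u) + β * f (y * u) + k u) :
    maximalFunction f z ≤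
      α * maximalFunction f x + β * maximalFunction f y + ∫ u in -1..1, k u := by
  refine csSup_le (averages_nonempty f z) fun A hA => ?_
  obtain ⟨s, ⟨hs0, hs1⟩, hAs⟩ := hf.exists_le_dilationMean hA
  have hc := hf.continuous
  have hint {g : ℝ → ℝ} (hg : Continuous g) : IntervalIntegrable g volume (-s) 1 :=
    hg.intervalIntegrable _ _
  have error : (1 + s)⁻¹ * ∫ u in -s..1, k u ≤ ∫ u in -1..1, k u := by
    have hsub : ∫ u in -s..1, k u ≤ ∫ u in -1..1, k u :=
      intervalIntegral.integral_mono_interval (by linarith) (by linarith) le_rfl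
        (.of_forall hk0) (hk.intervalIntegrable _ _)
    have h0 : 0 ≤ ∫ u in -s..1, k u :=
      intervalIntegral.integral_nonneg (by linarith) fun u _ => hk0 u
    exact (mul_le_of_le_one_left h0 (inv_le_one_of_one_le₀ (by linarith))).trans hsub
  calc A ≤ (1 + s)⁻¹ * ∫ u in -s..1, f (z * u) := hAs
    _ ≤ (1 + s)⁻¹ * ∫ u in -s..1, (α * f (x * u) + β * f (y * u) + k u) := by
      gcongr
      exact intervalIntegral.integral_mono_on (by linarith) (hint (by fun_prop))
        (hint (by fun_prop)) fun u _ => h u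
    _ = α * dilationMean f s x + β * dilationMean f s y + (1 + s)⁻¹ * ∫ u in -s..1, k u := by
      rw [intervalIntegral.integral_add (hint (by fun_prop)) (hint hk),
        intervalIntegral.integral_add (hint (by fun_prop)) (hint (by fun_prop)),
        intervalIntegral.integral_const_mul, intervalIntegral.integral_const_mul]
      simp only [dilationMean]
      ring
    _ ≤ α * maximalFunction f x + β * maximalFunction f y + ∫ u in -1..1, k u := by
      gcongr
      · exact hf.dilationMean_le_maximalFunction hs0 x
      · exact hf.dilationMean_le_maximalFunction hs0 y

theorem abs_maximalFunction_sub_le (hf : Bell f) (x y : ℝ) :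
    |maximalFunction f x - maximalFunction f y| ≤ ∫ u in -1..1, |f (x * u) - f (y * u)| := by
  have hc := hf.continuous
  have oneSided (x y : ℝ) : maximalFunction f x - maximalFunction f y ≤
      ∫ u in -1..1, |f (x * u) - f (y * u)| := by
    have := hf.maximalFunction_le_of_dilations_le (x := y) (y := y) (z := x) zero_le_one le_rfl
      (k := fun u => |f (x * u) - f (y * u)|) (by fun_prop) (fun u => abs_nonneg _)
      fun u => by linarith [le_abs_self (f (x * u) - f (y * u))]
    linarith
  refine abs_sub_le_iff.2 ⟨oneSided x y, ?_⟩
  simpa only [abs_sub_comm] using oneSided y x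

theorem convexOn_maximalFunction_add (hf : Bell f) {K : ℝ → ℝ} (hKc : Continuous K)
    (hK : ConvexOn ℝ univ K) (hfK : ConvexOn ℝ univ fun x => f x + K x) :
    ConvexOn ℝ univ fun x => maximalFunction f x + ∫ u in -1..1, K (x * u) := by
  refine ⟨convex_univ, fun x _ y _ α β hα hβ hαβ => ?_⟩
  simp only [smul_eq_mul]
  have dilate (u : ℝ) : (α * x + β * y) * u = α * (x * u) + β * (y * u) := by ring
  have main := hf.maximalFunction_le_of_dilations_le (x := x) (y := y) (z := α * x + β * y) hα hβ
    (k := fun u => α * K (x * u) + β * K (y * u) - K ((α * x + β * y) * u)) (by fun_prop)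
    (fun u => ?_) fun u => ?_
  · rw [intervalIntegral.integral_sub (Continuous.intervalIntegrable (by fun_prop) _ _)
        (Continuous.intervalIntegrable (by fun_prop) _ _),
      intervalIntegral.integral_add (Continuous.intervalIntegrable (by fun_prop) _ _)
        (Continuous.intervalIntegrable (by fun_prop) _ _),
      intervalIntegral.integral_const_mul, intervalIntegral.integral_const_mul] at main
    linarith
  · have := hK.2 (mem_univ (x * u)) (mem_univ (y * u)) hα hβ hαβ
    simp only [smul_eq_mul, ← dilate] at this
    exact sub_nonneg.2 this
  · have := hfK.2 (mem_univ (x * u)) (mem_univ (y * u)) hα hβ hαβ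
    simp only [smul_eq_mul, ← dilate] at this
    linarith

end Bell

/-! ### Weak differentiability of the maximal function -/

theorem scale_mem_disjWithin {R c : ℝ} (hR : 0 ≤ R) (hc0 : 0 < c) (hc1 : c ≤ 1) {n : ℕ}
    {I : ℕ → ℝ × ℝ} (hI : (n, I) ∈ AbsolutelyContinuousOnInterval.disjWithin (-R) R) :
    (n, fun i => ((I i).1 * c, (I i).2 * c)) ∈
      AbsolutelyContinuousOnInterval.disjWithin (-R) R := by
  obtain ⟨hmem, hdisj⟩ := hI
  have endpoint {x : ℝ} (hx : x ∈ uIcc (-R) R) : x * c ∈ uIcc (-R) R := by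
    rw [uIcc_of_le (by linarith)] at hx ⊢
    rw [mem_Icc, ← abs_le] at hx ⊢
    rw [abs_mul, abs_of_pos hc0]
    exact (mul_le_of_le_one_right (abs_nonneg x) hc1).trans hx
  have interval (i : ℕ) {t : ℝ} (ht : t ∈ uIoc ((I i).1 * c) ((I i).2 * c)) :
      t / c ∈ uIoc (I i).1 (I i).2 := by
    simpa only [mem_uIoc, lt_div_iff₀ hc0, div_le_iff₀ hc0] using ht
  exact ⟨fun i hi => ⟨endpoint (hmem i hi).1, endpoint (hmem i hi).2⟩,
    fun i hi j hj hij => disjoint_left.2 fun t hti htj =>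
      disjoint_left.1 (hdisj hi hj hij) (interval i hti) (interval j htj)⟩

theorem Bell.absolutelyContinuousOnInterval_maximalFunction {f : ℝ → ℝ} (hf : Bell f) {R : ℝ}
    (hR : 0 ≤ R) (hac : AbsolutelyContinuousOnInterval f (-R) R) :
    AbsolutelyContinuousOnInterval (maximalFunction f) (-R) R := by
  rw [absolutelyContinuousOnInterval_iff] at hac ⊢
  intro ε hε
  obtain ⟨δ, hδ, hfδ⟩ := hac (ε / 3) (by positivity)
  refine ⟨δ, hδ, fun ⟨n, I⟩ hI hIδ => ?_⟩
  have hc := hf.continuous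
  have dilated (u : ℝ) (hu : u ∈ Icc (-1) 1) :
      ∑ i ∈ Finset.range n, |f ((I i).1 * u) - f ((I i).2 * u)| ≤ ε / 3 := by
    have even (x : ℝ) : f (x * u) = f (x * |u|) := by
      rw [← hf.apply_abs, abs_mul, ← hf.apply_abs (x * |u|), abs_mul, abs_abs]
    rcases eq_or_ne u 0 with rfl | hu0
    · simpa using by positivity
    simp only [even]
    refine (hfδ _ (scale_mem_disjWithin hR (abs_pos.2 hu0) (abs_le.2 hu) hI) ?_).le
    refine (Finset.sum_le_sum fun i _ => ?_).trans_lt hIδ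
    rw [Real.dist_eq, ← sub_mul, abs_mul, abs_abs, Real.dist_eq]
    exact mul_le_of_le_one_right (abs_nonneg _) (abs_le.2 hu)
  calc ∑ i ∈ Finset.range n, |maximalFunction f (I i).1 - maximalFunction f (I i).2|
      ≤ ∑ i ∈ Finset.range n, ∫ u in -1..1, |f ((I i).1 * u) - f ((I i).2 * u)| :=
        Finset.sum_le_sum fun i _ => hf.abs_maximalFunction_sub_le _ _
    _ = ∫ u in -1..1, ∑ i ∈ Finset.range n, |f ((I i).1 * u) - f ((I i).2 * u)| :=
        (intervalIntegral.integral_finsetSum fun i _ =>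
          Continuous.intervalIntegrable (by fun_prop) _ _).symm
    _ ≤ ∫ _ in -1..1, ε / 3 :=
        intervalIntegral.integral_mono_on (by norm_num)
          (Continuous.intervalIntegrable (by fun_prop) _ _) (by simp) dilated
    _ < ε := by
        rw [intervalIntegral.integral_const, smul_eq_mul]
        linarith

theorem hasWeakDeriv_deriv_of_absolutelyContinuousOnInterval {F : ℝ → ℝ}
    (hF : ∀ R > 0, AbsolutelyContinuousOnInterval F (-R) R) : HasWeakDeriv F (deriv F) := by
  have hFc : Continuous F := continuous_iff_continuousAt.2 fun x => by
    have hR : -(|x| + 1) ≤ |x| + 1 := by linarith [abs_nonneg x]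
    refine (hF (|x| + 1) (by positivity)).continuousOn.continuousAt ?_
    rw [uIcc_of_le hR]
    exact Icc_mem_nhds (by linarith [neg_abs_le x]) (by linarith [le_abs_self x])
  have hF' : LocallyIntegrable (deriv F) := fun x =>
    ⟨Ioc (-(|x| + 1)) (|x| + 1),
      Ioc_mem_nhds (by linarith [neg_abs_le x]) (by linarith [le_abs_self x]),
      (hF (|x| + 1) (by positivity)).intervalIntegrable_deriv.1⟩
  refine ⟨hFc.locallyIntegrable, hF', fun φ hφ hφs => ?_⟩
  obtain ⟨R, hR, hsupp⟩ := hφs.isCompact.isBounded.subset_ball_lt 0 0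
  rw [Real.ball_eq_Ioo, zero_sub, zero_add] at hsupp
  have integral_eq {g : ℝ → ℝ} (hg : Function.support g ⊆ tsupport φ) :
      ∫ x, g x = ∫ x in -R..R, g x :=
    (intervalIntegral.integral_eq_integral_of_support_subset
      ((hg.trans hsupp).trans Ioo_subset_Ioc_self)).symm
  have endpoint {x : ℝ} (hx : x ∉ Ioo (-R) R) : φ x = 0 :=
    image_eq_zero_of_notMem_tsupport fun hxs => hx (hsupp hxs)
  rw [integral_eq ((Function.support_mul_subset_right _ _).trans support_deriv_subset),
    integral_eq ((Function.support_mul_subset_right _ _).trans subset_closure),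
    (hF R hR).integral_mul_deriv_eq_deriv_mul hφ.contDiffOn.absolutelyContinuousOnInterval,
    endpoint (by simp), endpoint (by simp)]
  ring

theorem absolutelyContinuousOnInterval_const_add_integral {q : ℝ → ℝ} (hq : LocallyIntegrable q)
    (c : ℝ) {R : ℝ} (hR : 0 < R) :
    AbsolutelyContinuousOnInterval (fun x => c + ∫ y in 0..x, q y) (-R) R :=
  AbsolutelyContinuousOnInterval.add contDiffOn_const.absolutelyContinuousOnInterval
    (IntervalIntegrable.absolutelyContinuousOnInterval_intervalIntegral
      (intervalIntegrable_of_locallyIntegrable hq _ _)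
      (mem_uIcc_of_le (neg_nonpos.2 hR.le) hR.le))

theorem HasWeakDeriv.exists_ae_eq_const_add_integral {f q : ℝ → ℝ} (hf : HasWeakDeriv f q) :
    ∃ c : ℝ, f =ᵐ[volume] fun x => c + ∫ y in 0..x, q y := by
  have hq := hf.locallyIntegrable_deriv
  set P : ℝ → ℝ := fun x => 0 + ∫ y in 0..x, q y
  have hP : HasWeakDeriv P (deriv P) := hasWeakDeriv_deriv_of_absolutelyContinuousOnInterval
    fun R => absolutelyContinuousOnInterval_const_add_integral hq 0
  have hPq : deriv P =ᵐ[volume] q := by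
    filter_upwards [LocallyIntegrable.ae_hasDerivAt_integral hq] with x hx
    exact ((hx 0).const_add 0).deriv
  obtain ⟨c, hc⟩ := exists_ae_eq_const_of_integral_mul_deriv_eq_zero
    (w := fun x => f x - P x) (hf.locallyIntegrable.sub hP.locallyIntegrable) fun φ hφ hφs => by
      have hφ' := hφ.continuous_deriv le_rfl
      have hPφ : ∫ x, deriv P x * φ x = ∫ x, q x * φ x :=
        integral_congr_ae (hPq.mono fun x hx => by simp only [hx])
      simp only [sub_mul]
      rw [integral_sub
          (integrable_mul_of_hasCompactSupport hf.locallyIntegrable hφ' hφs.deriv)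
          (integrable_mul_of_hasCompactSupport hP.locallyIntegrable hφ' hφs.deriv),
        hf.integral_mul_deriv φ hφ hφs, hP.integral_mul_deriv φ hφ hφs, hPφ, sub_self]
  refine ⟨c, hc.mono fun x hx => ?_⟩
  simpa only [P, zero_add, sub_eq_iff_eq_add] using hx

theorem even_of_ae_eq {f F : ℝ → ℝ} (hf : Function.Even f) (hF : Continuous F)
    (h : f =ᵐ[volume] F) : Function.Even F := by
  have hneg : ∀ᵐ x : ℝ, f (-x) = F (-x) :=
    (Measure.measurePreserving_neg (volume : Measure ℝ)).quasiMeasurePreserving.ae h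
  refine congrFun ((Continuous.ae_eq_iff_eq volume (hF.comp continuous_neg) hF).1 ?_)
  filter_upwards [h, hneg] with x hx hnx
  rw [Function.comp_apply, ← hnx, hf x, hx]

theorem antitoneOn_Ici_of_ae_eq {f F : ℝ → ℝ} {a : ℝ} (hf : AntitoneOn f (Ioi a))
    (hF : Continuous F) (h : f =ᵐ[volume] F) : AntitoneOn F (Ici a) := by
  have hdense : Dense {x | f x = F x} := Measure.dense_of_ae h
  have after {s : ℝ} (hs : a < s) (hfs : f s = F s) : Ioi s ⊆ {y | F y ≤ F s} :=
    (hdense.open_subset_closure_inter isOpen_Ioi).trans <|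
      closure_minimal (fun y ⟨hsy, hfy⟩ => by
        rw [mem_ofPred_eq, ← hfs, ← show f y = F y from hfy]
        exact hf hs (hs.trans hsy) (le_of_lt hsy)) (isClosed_le hF continuous_const)
  intro x hx y hy hxy
  rcases hxy.eq_or_lt with rfl | hxy
  · rfl
  rw [mem_Ici] at hx
  have before : Ioo a y ⊆ {x | F y ≤ F x} :=
    (hdense.open_subset_closure_inter isOpen_Ioo).trans <|
      closure_minimal (fun s ⟨hs, hfs⟩ => after hs.1 hfs hs.2) (isClosed_le continuous_const hF)
  refine closure_minimal before (isClosed_le continuous_const hF) ?_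
  rw [closure_Ioo (hx.trans_lt hxy).ne]
  exact ⟨hx, hxy.le⟩

theorem HasWeakDeriv.exists_bell {f q : ℝ → ℝ} (hf : HasWeakDeriv f q) (heven : Function.Even f)
    (hanti : AntitoneOn f (Ioi 0)) :
    ∃ c : ℝ, Bell (fun x => c + ∫ y in 0..x, q y) ∧ f =ᵐ[volume] fun x => c + ∫ y in 0..x, q y := by
  obtain ⟨c, hc⟩ := hf.exists_ae_eq_const_add_integral
  have hcont : Continuous fun x => c + ∫ y in 0..x, q y :=
    continuous_const.add (intervalIntegral.continuous_primitive
      (intervalIntegrable_of_locallyIntegrable hf.locallyIntegrable_deriv) 0)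
  exact ⟨c, ⟨hcont, even_of_ae_eq heven hcont hc, antitoneOn_Ici_of_ae_eq hanti hcont hc⟩, hc⟩

/-! ### Variation of the derivative of the maximal function -/

theorem exists_convexOn_add_integral {q : ℝ → ℝ} (hq : LocallyIntegrable q)
    (hV : variation q ≠ ∞) :
    ∃ K : ℝ → ℝ, Continuous K ∧ ConvexOn ℝ univ K ∧ (∀ x, K x ≤ (variation q).toReal * |x|) ∧
      ConvexOn ℝ univ fun x => (∫ y in 0..x, q y) + K x := by
  obtain ⟨n, m, hn, hnV, hm, hqnm⟩ := exists_monotone_add_ae_eq_monotone hq hV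
  have hnint (a b : ℝ) : IntervalIntegrable n volume a b := hn.intervalIntegrable
  refine ⟨fun x => ∫ y in 0..x, n y, intervalIntegral.continuous_primitive hnint 0,
    convexOn_integral_of_monotone hn 0, fun x => ?_, ?_⟩
  · have := intervalIntegral.norm_integral_le_of_norm_le_const (f := n)
      (a := 0) (b := x) fun y _ => hnV y
    rw [sub_zero] at this
    exact (le_abs_self _).trans this
  · have sum_eq (x : ℝ) : (∫ y in 0..x, q y) + ∫ y in 0..x, n y = ∫ y in 0..x, m y := by
      rw [← intervalIntegral.integral_add (intervalIntegrable_of_locallyIntegrable hq _ _)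
        (hnint _ _)]
      exact intervalIntegral.integral_congr_ae (hqnm.mono fun y hy _ => hy)
    simpa only [sum_eq] using convexOn_integral_of_monotone hm 0

theorem convexOn_integral_comp_mul {K : ℝ → ℝ} (hKc : Continuous K) (hK : ConvexOn ℝ univ K)
    {a b : ℝ} (hab : a ≤ b) : ConvexOn ℝ univ fun x => ∫ u in a..b, K (x * u) := by
  refine ⟨convex_univ, fun x _ y _ α β hα hβ hαβ => ?_⟩
  simp only [smul_eq_mul]
  rw [← intervalIntegral.integral_const_mul, ← intervalIntegral.integral_const_mul,
    ← intervalIntegral.integral_add (Continuous.intervalIntegrable (by fun_prop) _ _)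
      (Continuous.intervalIntegrable (by fun_prop) _ _)]
  refine intervalIntegral.integral_mono_on hab (Continuous.intervalIntegrable (by fun_prop) _ _)
    (Continuous.intervalIntegrable (by fun_prop) _ _) fun u _ => ?_
  simpa only [smul_eq_mul, add_mul, mul_assoc] using
    hK.2 (mem_univ (x * u)) (mem_univ (y * u)) hα hβ hαβ

theorem integral_abs_neg_one_one : ∫ u in (-1 : ℝ)..1, |u| = 1 := by
  have neg_half : ∫ u in (-1 : ℝ)..0, |u| = ∫ u in (-1 : ℝ)..0, -u :=
    intervalIntegral.integral_congr fun u hu => abs_of_nonpos (by simp_all)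
  have pos_half : ∫ u in (0 : ℝ)..1, |u| = ∫ u in (0 : ℝ)..1, u :=
    intervalIntegral.integral_congr fun u hu => abs_of_nonneg (by simp_all)
  rw [← intervalIntegral.integral_add_adjacent_intervals (b := 0)
      (continuous_abs.intervalIntegrable _ _) (continuous_abs.intervalIntegrable _ _),
    neg_half, pos_half, intervalIntegral.integral_neg, integral_id, integral_id]
  norm_num

theorem Bell.variation_deriv_maximalFunction_le_of_convexOn_add {f K : ℝ → ℝ} (hf : Bell f)
    (hKc : Continuous K) (hK : ConvexOn ℝ univ K) (hfK : ConvexOn ℝ univ fun x => f x + K x)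
    {L : ℝ≥0} (hKL : ∀ x, K x ≤ L * |x|) : variation (deriv (maximalFunction f)) ≤ 4 * L := by
  refine variation_deriv_le_of_convexOn_add (K := fun x => ∫ u in -1..1, K (x * u)) ?_
    (hf.convexOn_maximalFunction_add hKc hK hfK) hf.maximalFunction_le fun x => ?_
  · exact convexOn_integral_comp_mul hKc hK (by norm_num)
  · calc ∫ u in -1..1, K (x * u) ≤ ∫ u in -1..1, L * |x| * |u| :=
          intervalIntegral.integral_mono_on (by norm_num)
            (Continuous.intervalIntegrable (by fun_prop) _ _)
            (Continuous.intervalIntegrable (by fun_prop) _ _) fun u _ => by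
              simpa only [abs_mul, mul_assoc] using hKL (x * u)
      _ = L * |x| := by rw [intervalIntegral.integral_const_mul, integral_abs_neg_one_one, mul_one]

theorem Bell.variation_deriv_maximalFunction_le {q : ℝ → ℝ} (hq : LocallyIntegrable q) {c : ℝ}
    (hf : Bell fun x => c + ∫ y in 0..x, q y) :
    variation (deriv (maximalFunction fun x => c + ∫ y in 0..x, q y)) ≤ 4 * variation q := by
  rcases eq_or_ne (variation q) ∞ with hV | hV
  · rw [hV, ENNReal.mul_top four_ne_zero]
    exact le_top
  obtain ⟨K, hKc, hK, hKV, hqK⟩ := exists_convexOn_add_integral hq hV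
  have hfK : ConvexOn ℝ univ fun x => (c + ∫ y in 0..x, q y) + K x := by
    simpa only [add_assoc, Pi.add_def] using (convexOn_const c convex_univ).add hqK
  calc variation (deriv (maximalFunction fun x => c + ∫ y in 0..x, q y))
      ≤ 4 * ↑(variation q).toNNReal :=
        hf.variation_deriv_maximalFunction_le_of_convexOn_add hKc hK hfK hKV
    _ = 4 * variation q := by rw [ENNReal.coe_toNNReal hV]

end UncenteredMaximal

theorem mainTheorem2 :
    ∃ C : ℝ, 0 < C ∧
      ∀ f : ℝ → ℝ, Function.Even f → AntitoneOn f (Set.Ioi 0) →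
        ∀ f' : ℝ → ℝ, UncenteredMaximal.HasWeakDeriv f f' →
          (∀ x : ℝ, BddAbove (UncenteredMaximal.averages f x)) ∧
          ∃ g : ℝ → ℝ,
            UncenteredMaximal.HasWeakDeriv (UncenteredMaximal.maximalFunction f) g ∧
            UncenteredMaximal.variation g ≤
              ENNReal.ofReal C * UncenteredMaximal.variation f' := by
  refine ⟨4, four_pos, fun f heven hanti f' hf => ?_⟩
  obtain ⟨c, hbell, hfc⟩ := hf.exists_bell heven hanti
  have hf' := hf.locallyIntegrable_deriv
  have averages_eq := UncenteredMaximal.averages_congr_ae hfc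
  have maximalFunction_eq : UncenteredMaximal.maximalFunction f =
      UncenteredMaximal.maximalFunction fun x => c + ∫ y in 0..x, f' y :=
    funext fun x => congrArg sSup (averages_eq x)
  rw [maximalFunction_eq, ENNReal.ofReal_ofNat]
  exact ⟨fun x => averages_eq x ▸ hbell.bddAbove_averages x, _,
    UncenteredMaximal.hasWeakDeriv_deriv_of_absolutelyContinuousOnInterval fun R hR =>
      hbell.absolutelyContinuousOnInterval_maximalFunction hR.le
        (UncenteredMaximal.absolutelyContinuousOnInterval_const_add_integral hf' c hR),
    hbell.variation_deriv_maximalFunction_le hf'⟩
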